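/- Let $n\ge 1$, $0<\theta<1$, $1\le q_0<p_0<\infty$ and $1\le q_1<p_1<\infty$ with $\frac{p_0}{q_0}=\frac{p_1}{q_1}$. For $1\le q\le p<\infty$ and a measurable $f:\mathbb R^n\to\mathbb C$ (functions equal almost everywhere are identified) put $$m(f,p,q;r)=\sup_{x\in\mathbb R^n}|B(x,r)|^{1/p}\Big(\frac1{|B(x,r)|}\int_{B(x,r)}|f(y)|^q\,dy\Big)^{1/q},\qquad \|f\|_{\mathcal M^p_q}=\sup_{r>0}m(f,p,q;r),$$ and let $\mathcal M^p_q$ be the Morrey space of all $f$ with $\|f\|_{\mathcal M^p_q}<\infty$. Let $$V_\infty\mathcal M^p_q=\{f\in\mathcal M^p_q:\ \lim_{r\to\infty}m(f,p,q;r)=0\},$$ $$V^{(*)}\mathcal M^p_q=\Big\{f\in\mathcal M^p_q:\ \lim_{N\to\infty}\sup_{x\in\mathbb R^n}\int_{B(x,1)}|f(y)|^q\chi_{\mathbb R^n\setminus B(0,N)}(y)\,dy=0\Big\},$$ both with the norm of $\mathcal M^p_q$. For a compatible couple $(X_0,X_1)$ of Banach spaces let $S=\{z\in\mathbb C:0<\operatorname{Re}z<1\}$,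 and let $\mathcal F(X_0,X_1)$ be the set of all bounded continuous functions $F:\overline S\to X_0+X_1$ that are holomorphic in $S$ and for which, for $k=0,1$, $t\mapsto F(k+it)$ is a bounded continuous function from $\mathbb R$ to $X_k$. The first complex interpolation space is $[X_0,X_1]_\theta=\{F(\theta):F\in\mathcal F(X_0,X_1)\}$. Let $$f_2=\sum_{j=1}^\infty\chi_{j!\,\mathbf e_1+[0,1]^n},\qquad \mathbf e_1=(1,0,\dots,0).$$ Then $$f_2\in[V_\infty\mathcal M^{p_0}_{q_0},V_\infty\mathcal M^{p_1}_{q_1}]_\theta\qquad\text{and}\qquad f_2\notin[V^{(*)}\mathcal M^{p_0}_{q_0},V^{(*)}\mathcal M^{p_1}_{q_1}]_\theta .$$ -/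

import Mathlib

open MeasureTheory Filter Topology Metric Complex.HadamardThreeLines
open scoped ENNReal BoundedContinuousFunction

noncomputable section

/-! ## The first complex interpolation space of a compatible couple -/

section Interpolation

variable {X₀ X₁ Z : Type*} [NormedAddCommGroup X₀] [NormedSpace ℂ X₀]
  [NormedAddCommGroup X₁] [NormedSpace ℂ X₁] [AddCommGroup Z] [Module ℂ Z]

/-- The linear map `(a, b) ↦ i₀ a + i₁ b`, where `X₀ × X₁` carries the norm `‖a‖ + ‖b‖`. -/
def sumMap (i₀ : X₀ →ₗ[ℂ] Z) (i₁ : X₁ →ₗ[ℂ] Z) : WithLp 1 (X₀ × X₁) →ₗ[ℂ] Z :=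
  (i₀.coprod i₁).comp (WithLp.linearEquiv 1 ℂ (X₀ × X₁)).toLinearMap

/-- A compatible couple: two normed spaces, embedded by injective linear maps into one vector space
`Z`, such that the infimum `inf {‖a‖ + ‖b‖ : x = i₀ a + i₁ b}` is a norm (not just a seminorm) on
`X₀ + X₁ ⊆ Z`, that is, `{(a, b) : i₀ a + i₁ b = 0}` is closed. This holds if and only if `X₀` and
`X₁` embed continuously, compatibly with `i₀` and `i₁`, into some Hausdorff topological vector
space; `X₀ + X₁` is then such a space. -/
class CompatibleCouple (i₀ : X₀ →ₗ[ℂ] Z) (i₁ : X₁ →ₗ[ℂ] Z) : Prop where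
  injective₀ : Function.Injective i₀
  injective₁ : Function.Injective i₁
  isClosed_ker : IsClosed (LinearMap.ker (sumMap i₀ i₁) : Set (WithLp 1 (X₀ × X₁)))

instance (i₀ : X₀ →ₗ[ℂ] Z) (i₁ : X₁ →ₗ[ℂ] Z) [h : CompatibleCouple i₀ i₁] :
    IsClosed (LinearMap.ker (sumMap i₀ i₁) : Set (WithLp 1 (X₀ × X₁))) :=
  h.isClosed_ker

/-- The space `X₀ + X₁`: as a vector space `(X₀ × X₁) / ker`, which is isomorphic to the subspace
`i₀ X₀ + i₁ X₁` of `Z`. Mathlib's quotient norm is `‖x‖ = inf {‖a‖ + ‖b‖ : x = i₀ a + i₁ b}`. -/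
abbrev SumSpace (i₀ : X₀ →ₗ[ℂ] Z) (i₁ : X₁ →ₗ[ℂ] Z) : Type _ :=
  WithLp 1 (X₀ × X₁) ⧸ LinearMap.ker (sumMap i₀ i₁)

/-- The (injective) inclusion of `X₀ + X₁` in `Z`. -/
def SumSpace.toZ (i₀ : X₀ →ₗ[ℂ] Z) (i₁ : X₁ →ₗ[ℂ] Z) : SumSpace i₀ i₁ →ₗ[ℂ] Z :=
  (LinearMap.ker (sumMap i₀ i₁)).liftQ (sumMap i₀ i₁) le_rfl

/-- The inclusion of `X₀` in `X₀ + X₁`. -/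
def SumSpace.inl (i₀ : X₀ →ₗ[ℂ] Z) (i₁ : X₁ →ₗ[ℂ] Z) (a : X₀) : SumSpace i₀ i₁ :=
  Submodule.Quotient.mk (WithLp.toLp 1 (a, 0))

/-- The inclusion of `X₁` in `X₀ + X₁`. -/
def SumSpace.inr (i₀ : X₀ →ₗ[ℂ] Z) (i₁ : X₁ →ₗ[ℂ] Z) (b : X₁) : SumSpace i₀ i₁ :=
  Submodule.Quotient.mk (WithLp.toLp 1 (0, b))

/-- Membership in Calderón's space `𝓕(X₀, X₁)`. Only the values of `F` on the closed strip
`0 ≤ Re z ≤ 1` matter. -/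
structure IsCalderonFunction (i₀ : X₀ →ₗ[ℂ] Z) (i₁ : X₁ →ₗ[ℂ] Z) [CompatibleCouple i₀ i₁]
    (F : ℂ → SumSpace i₀ i₁) : Prop where
  continuousOn : ContinuousOn F (verticalClosedStrip 0 1)
  bounded : ∃ C : ℝ, ∀ z ∈ verticalClosedStrip 0 1, ‖F z‖ ≤ C
  holomorphic : DifferentiableOn ℂ F (verticalStrip 0 1)
  /-- `t ↦ F (it)` is a bounded continuous map into `X₀`. -/
  boundary₀ : ∃ g : ℝ →ᵇ X₀, ∀ t : ℝ, F (t * Complex.I) = SumSpace.inl i₀ i₁ (g t)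
  /-- `t ↦ F (1 + it)` is a bounded continuous map into `X₁`. -/
  boundary₁ : ∃ g : ℝ →ᵇ X₁, ∀ t : ℝ, F (1 + t * Complex.I) = SumSpace.inr i₀ i₁ (g t)

/-- The first complex interpolation space `[X₀, X₁]_θ = {F(θ) : F ∈ 𝓕(X₀, X₁)}`, as a set of
elements of the ambient vector space `Z`. -/
def firstInterpolation (i₀ : X₀ →ₗ[ℂ] Z) (i₁ : X₁ →ₗ[ℂ] Z) [CompatibleCouple i₀ i₁]
    (θ : ℝ) : Set Z :=
  {f | ∃ F : ℂ → SumSpace i₀ i₁, IsCalderonFunction i₀ i₁ F ∧ SumSpace.toZ i₀ i₁ (F θ) = f}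

end Interpolation

/-! ## Morrey spaces -/

/-- Measurable functions `ℝⁿ → ℂ` modulo equality almost everywhere. -/
abbrev MeasClass (n : ℕ) : Type := EuclideanSpace ℝ (Fin n) →ₘ[volume] ℂ

/-- `|B(x,r)|^(1/p) (|B(x,r)|⁻¹ ∫_{B(x,r)} |f|^q)^(1/q)`. -/
def morreyLocal {n : ℕ} (p q : ℝ) (f : MeasClass n) (x : EuclideanSpace ℝ (Fin n)) (r : ℝ) :
    ℝ≥0∞ :=
  volume (ball x r) ^ (1 / p) * (⨍⁻ y in ball x r, ‖f y‖ₑ ^ q ∂volume) ^ (1 / q)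

/-- `m(f,p,q;r)`, the supremum over all balls of radius `r`. -/
def morreyM {n : ℕ} (p q : ℝ) (f : MeasClass n) (r : ℝ) : ℝ≥0∞ :=
  ⨆ x : EuclideanSpace ℝ (Fin n), morreyLocal p q f x r

/-- The Morrey norm `sup_{r > 0} m(f,p,q;r)`, with values in `[0,∞]`. -/
def morreyENorm {n : ℕ} (p q : ℝ) (f : MeasClass n) : ℝ≥0∞ :=
  ⨆ (r : ℝ) (_ : 0 < r), morreyM p q f r

section Basic

variable {n : ℕ} {p q : ℝ}

lemma morreyLocal_zero (hq : 0 < q) (x : EuclideanSpace ℝ (Fin n)) (r : ℝ) :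
    morreyLocal p q (0 : MeasClass n) x r = 0 := by
  have h : (⨍⁻ y in ball x r, ‖(0 : MeasClass n) y‖ₑ ^ q ∂volume) = 0 := by
    rw [laverage_eq']
    have : ∫⁻ y, ‖(0 : MeasClass n) y‖ₑ ^ q ∂(volume.restrict (ball x r)) = 0 := by
      rw [lintegral_congr_ae (g := fun _ => 0)]
      · simp
      · filter_upwards [ae_restrict_of_ae (AEEqFun.coeFn_zero (μ := volume)
          (α := EuclideanSpace ℝ (Fin n)) (β := ℂ))] with y hy
        simp [hy, hq]
    rw [lintegral_smul_measure, this]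
    simp
  rw [morreyLocal, h, ENNReal.zero_rpow_of_pos (by positivity), mul_zero]

lemma morreyLocal_add_le (hq : 1 ≤ q) (f g : MeasClass n) (x : EuclideanSpace ℝ (Fin n)) (r : ℝ) :
    morreyLocal p q (f + g) x r ≤ morreyLocal p q f x r + morreyLocal p q g x r := by
  unfold morreyLocal
  rw [← mul_add]
  gcongr
  simp only [laverage_eq', lintegral_smul_measure, smul_eq_mul]
  set c := (volume.restrict (ball x r) Set.univ)⁻¹
  have hq0 : 0 < q := by linarith
  have h1 : ∫⁻ y in ball x r, ‖(f + g) y‖ₑ ^ q ≤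
      ∫⁻ y in ball x r, ((fun y => ‖f y‖ₑ) + fun y => ‖g y‖ₑ) y ^ q := by
    refine lintegral_mono_ae ?_
    filter_upwards [ae_restrict_of_ae (AEEqFun.coeFn_add f g)] with y hy
    rw [hy]
    exact ENNReal.rpow_le_rpow (enorm_add_le _ _) hq0.le
  have h2 := ENNReal.lintegral_Lp_add_le (μ := volume.restrict (ball x r))
    (f := fun y => ‖f y‖ₑ) (g := fun y => ‖g y‖ₑ)
    f.aestronglyMeasurable.enorm.restrict g.aestronglyMeasurable.enorm.restrict hq
  rw [ENNReal.mul_rpow_of_nonneg _ _ (by positivity), ENNReal.mul_rpow_of_nonneg _ _ (by positivity),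
    ENNReal.mul_rpow_of_nonneg _ _ (by positivity), ← mul_add]
  gcongr
  exact (ENNReal.rpow_le_rpow h1 (by positivity)).trans h2

lemma morreyLocal_smul (hq : 0 < q) (c : ℂ) (f : MeasClass n) (x : EuclideanSpace ℝ (Fin n))
    (r : ℝ) : morreyLocal p q (c • f) x r = ‖c‖ₑ * morreyLocal p q f x r := by
  unfold morreyLocal
  simp only [laverage_eq', lintegral_smul_measure, smul_eq_mul]
  have h1 : ∫⁻ y in ball x r, ‖(c • f) y‖ₑ ^ q =
      ‖c‖ₑ ^ q * ∫⁻ y in ball x r, ‖f y‖ₑ ^ q := by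
    rw [← lintegral_const_mul' _ _ (ENNReal.rpow_ne_top_of_nonneg hq.le enorm_ne_top)]
    refine lintegral_congr_ae ?_
    filter_upwards [ae_restrict_of_ae (AEEqFun.coeFn_smul c f)] with y hy
    rw [hy, Pi.smul_apply, smul_eq_mul, enorm_mul, ENNReal.mul_rpow_of_nonneg _ _ hq.le]
  rw [h1, ENNReal.mul_rpow_of_nonneg _ _ (by positivity), ENNReal.mul_rpow_of_nonneg _ _ (by positivity),
    ENNReal.mul_rpow_of_nonneg _ _ (by positivity), ← ENNReal.rpow_mul, mul_one_div_cancel hq.ne',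
    ENNReal.rpow_one]
  ring

lemma morreyM_zero (hq : 0 < q) (r : ℝ) : morreyM p q (0 : MeasClass n) r = 0 := by
  simp [morreyM, morreyLocal_zero hq]

lemma morreyM_add_le (hq : 1 ≤ q) (f g : MeasClass n) (r : ℝ) :
    morreyM p q (f + g) r ≤ morreyM p q f r + morreyM p q g r :=
  iSup_le fun x => (morreyLocal_add_le hq f g x r).trans
    (add_le_add (le_iSup (fun x => morreyLocal p q f x r) x)
      (le_iSup (fun x => morreyLocal p q g x r) x))

lemma morreyM_smul (hq : 0 < q) (c : ℂ) (f : MeasClass n) (r : ℝ) :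
    morreyM p q (c • f) r = ‖c‖ₑ * morreyM p q f r := by
  simp only [morreyM, morreyLocal_smul hq, ENNReal.mul_iSup]

lemma morreyM_le_morreyENorm (f : MeasClass n) {r : ℝ} (hr : 0 < r) :
    morreyM p q f r ≤ morreyENorm p q f :=
  le_iSup₂ (f := fun (r : ℝ) (_ : 0 < r) => morreyM p q f r) r hr

lemma morreyENorm_zero (hq : 0 < q) : morreyENorm p q (0 : MeasClass n) = 0 := by
  simp [morreyENorm, morreyM_zero hq]

lemma morreyENorm_add_le (hq : 1 ≤ q) (f g : MeasClass n) :
    morreyENorm p q (f + g) ≤ morreyENorm p q f + morreyENorm p q g :=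
  iSup₂_le fun r hr => (morreyM_add_le hq f g r).trans
    (add_le_add (morreyM_le_morreyENorm f hr) (morreyM_le_morreyENorm g hr))

lemma morreyENorm_smul (hq : 0 < q) (c : ℂ) (f : MeasClass n) :
    morreyENorm p q (c • f) = ‖c‖ₑ * morreyENorm p q f := by
  simp only [morreyENorm, morreyM_smul hq, ENNReal.mul_iSup]

/-- The Morrey norm controls the `L¹` norm on balls. -/
lemma lintegral_ball_le_morreyENorm (hq : 1 ≤ q) {r : ℝ} (hr : 0 < r) :
    ∃ C : ℝ≥0∞, C ≠ ∞ ∧ ∀ f : MeasClass n,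
      ∫⁻ y in ball (0 : EuclideanSpace ℝ (Fin n)) r, ‖f y‖ₑ ≤ C * morreyENorm p q f := by
  set B := ball (0 : EuclideanSpace ℝ (Fin n)) r
  have hB0 : volume B ≠ 0 := (measure_ball_pos volume _ hr).ne'
  have hBt : volume B ≠ ∞ := measure_ball_lt_top.ne
  have hw0 : volume B ^ (1 / p) ≠ 0 := by simp [ENNReal.rpow_eq_zero_iff, hB0, hBt]
  have hwt : volume B ^ (1 / p) ≠ ∞ := by simp [ENNReal.rpow_eq_top_iff, hB0, hBt]
  refine ⟨volume B * (volume B ^ (1 / p))⁻¹,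
    ENNReal.mul_ne_top hBt (ENNReal.inv_ne_top.2 hw0), fun f => ?_⟩
  have hprob : IsProbabilityMeasure ((volume B)⁻¹ • volume.restrict B) := by
    constructor
    simp [ENNReal.inv_mul_cancel hB0 hBt]
  have h1 := eLpNorm'_le_eLpNorm'_of_exponent_le (p := 1) (q := q) one_pos hq
    ((volume B)⁻¹ • volume.restrict B) (f := f)
    (f.aestronglyMeasurable.restrict.smul_measure _)
  have h2 : morreyLocal p q f 0 r ≤ morreyENorm p q f :=
    (le_iSup (fun x => morreyLocal p q f x r) 0).trans (morreyM_le_morreyENorm f hr)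
  have h3 : morreyLocal p q f 0 r =
      volume B ^ (1 / p) * eLpNorm' f q ((volume B)⁻¹ • volume.restrict B) := by
    simp [morreyLocal, eLpNorm'_eq_lintegral_enorm, laverage_eq', B]
  have h4 : eLpNorm' f 1 ((volume B)⁻¹ • volume.restrict B) =
      (volume B)⁻¹ * ∫⁻ y in B, ‖f y‖ₑ := by
    simp [eLpNorm'_eq_lintegral_enorm]
  calc ∫⁻ y in B, ‖f y‖ₑ = volume B * ((volume B)⁻¹ * ∫⁻ y in B, ‖f y‖ₑ) := by
        rw [← mul_assoc, ENNReal.mul_inv_cancel hB0 hBt, one_mul]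
    _ ≤ volume B * eLpNorm' f q ((volume B)⁻¹ • volume.restrict B) := by
        rw [← h4]; gcongr
    _ = volume B * (volume B ^ (1 / p))⁻¹ * morreyLocal p q f 0 r := by
        rw [h3, mul_assoc, ← mul_assoc (volume B ^ (1 / p))⁻¹, ENNReal.inv_mul_cancel hw0 hwt,
          one_mul]
    _ ≤ _ := by gcongr

lemma eq_zero_of_lintegral_ball (f : MeasClass n)
    (h : ∀ r : ℝ, 0 < r → ∫⁻ y in ball (0 : EuclideanSpace ℝ (Fin n)) r, ‖f y‖ₑ = 0) : f = 0 := by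
  apply AEEqFun.ext
  have h1 : ∀ k : ℕ, ∀ᵐ y ∂volume.restrict (ball (0 : EuclideanSpace ℝ (Fin n)) (k + 1)),
      f y = 0 := by
    intro k
    have := (lintegral_eq_zero_iff' f.aestronglyMeasurable.enorm.restrict).1
      (h (k + 1) (by positivity))
    filter_upwards [this] with y hy
    simpa using hy
  have h2 := (ae_restrict_iUnion_iff
    (fun k : ℕ => ball (0 : EuclideanSpace ℝ (Fin n)) (k + 1)) (fun y => f y = 0)).2 h1
  have h3 : (⋃ k : ℕ, ball (0 : EuclideanSpace ℝ (Fin n)) ((k : ℝ) + 1)) = Set.univ := by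
    refine Set.eq_univ_of_forall fun y => Set.mem_iUnion.2 ?_
    obtain ⟨k, hk⟩ := exists_nat_gt ‖y‖
    exact ⟨k, by rw [mem_ball_zero_iff]; linarith⟩
  rw [h3, Measure.restrict_univ] at h2
  filter_upwards [h2, AEEqFun.coeFn_zero (μ := volume) (α := EuclideanSpace ℝ (Fin n))
    (β := ℂ)] with y hy hy'
  rw [hy, hy', Pi.zero_apply]

lemma eq_zero_of_morreyENorm (hq : 1 ≤ q) {f : MeasClass n} (h : morreyENorm p q f = 0) :
    f = 0 := by
  refine eq_zero_of_lintegral_ball f fun r hr => ?_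
  obtain ⟨C, -, hC⟩ := lintegral_ball_le_morreyENorm (n := n) (p := p) hq hr
  simpa [h] using hC f

end Basic

variable (n : ℕ) (p q : ℝ) [hq : Fact (1 ≤ q)]

/-- The Morrey space `𝓜^p_q(ℝⁿ)`. Finiteness of the norm includes local `q`-integrability. -/
def morreySpace : Submodule ℂ (MeasClass n) where
  carrier := {f | morreyENorm p q f < ∞}
  zero_mem' := by
    simp [morreyENorm_zero (lt_of_lt_of_le one_pos hq.out)]
  add_mem' {f g} hf hg :=
    (morreyENorm_add_le hq.out f g).trans_lt (ENNReal.add_lt_top.2 ⟨hf, hg⟩)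
  smul_mem' c f hf := by
    simp only [Set.mem_ofPred_eq, morreyENorm_smul (lt_of_lt_of_le one_pos hq.out)]
    exact ENNReal.mul_lt_top enorm_lt_top hf

/-- The Morrey norm makes `𝓜^p_q` a normed space. -/
instance : NormedAddCommGroup (morreySpace n p q) :=
  AddGroupNorm.toNormedAddCommGroup
    { toFun := fun f => (morreyENorm p q f.1).toReal
      map_zero' := by simp [morreyENorm_zero (lt_of_lt_of_le one_pos hq.out)]
      add_le' := fun f g => by
        rw [← ENNReal.toReal_add f.2.ne g.2.ne]
        exact ENNReal.toReal_mono (ENNReal.add_ne_top.2 ⟨f.2.ne, g.2.ne⟩)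
          (morreyENorm_add_le hq.out f.1 g.1)
      neg' := fun f => by
        have h := morreyENorm_smul (p := p) (lt_of_lt_of_le one_pos hq.out) (-1 : ℂ) f.1
        rw [enorm_neg, enorm_one, one_mul] at h
        rw [Submodule.coe_neg, ← h]
        exact congrArg (fun g => (morreyENorm p q g).toReal) (neg_one_smul ℂ f.1).symm
      eq_zero_of_map_eq_zero' := fun f hf => by
        rcases (ENNReal.toReal_eq_zero_iff _).1 hf with h | h
        · exact Subtype.ext (eq_zero_of_morreyENorm hq.out h)
        · exact absurd h f.2.ne }

lemma norm_morreySpace_def (f : morreySpace n p q) : ‖f‖ = (morreyENorm p q f.1).toReal := rfl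

instance : NormedSpace ℂ (morreySpace n p q) where
  norm_smul_le c f := by
    rw [norm_morreySpace_def, norm_morreySpace_def, Submodule.coe_smul,
      morreyENorm_smul (lt_of_lt_of_le one_pos hq.out), ENNReal.toReal_mul, toReal_enorm]

/-- The vanishing Morrey space at infinity `V_∞𝓜^p_q`, with the Morrey norm. -/
def vanishingAtInfinity : Submodule ℂ (morreySpace n p q) where
  carrier := {f | Tendsto (fun r : ℝ => morreyM p q f.1 r) atTop (𝓝 0)}
  zero_mem' := by
    simp [morreyM_zero (lt_of_lt_of_le one_pos hq.out)]
  add_mem' {f g} hf hg := by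
    have h := Tendsto.add hf hg
    rw [add_zero] at h
    exact tendsto_of_tendsto_of_tendsto_of_le_of_le tendsto_const_nhds h (fun _ => zero_le)
      (fun r => morreyM_add_le hq.out f.1 g.1 r)
  smul_mem' c f hf := by
    have h := ENNReal.Tendsto.const_mul (a := ‖c‖ₑ) hf (Or.inr enorm_ne_top)
    rw [mul_zero] at h
    simpa [morreyM_smul (lt_of_lt_of_le one_pos hq.out)] using h

/-- `sup_x ∫_{B(x,1)} |f|^q χ_{ℝⁿ ∖ B(0,N)}`. -/
def unitBallTail {n : ℕ} (q : ℝ) (f : MeasClass n) (N : ℕ) : ℝ≥0∞ :=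
  ⨆ x : EuclideanSpace ℝ (Fin n),
    ∫⁻ y in ball x 1, ((ball 0 N)ᶜ).indicator (fun y => ‖f y‖ₑ ^ q) y

lemma unitBallTail_zero {n : ℕ} {q : ℝ} (hq : 0 < q) (N : ℕ) :
    unitBallTail q (0 : MeasClass n) N = 0 := by
  refine le_antisymm (iSup_le fun x => ?_) zero_le
  rw [lintegral_congr_ae (g := fun _ => 0)]
  · simp
  · filter_upwards [ae_restrict_of_ae (AEEqFun.coeFn_zero (μ := volume)
      (α := EuclideanSpace ℝ (Fin n)) (β := ℂ))] with y hy
    by_cases h : y ∈ (ball (0 : EuclideanSpace ℝ (Fin n)) N)ᶜ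
    · simp [Set.indicator_of_mem h, hq]
    · simp [Set.indicator_of_notMem h]

lemma unitBallTail_add_le {n : ℕ} {q : ℝ} (hq : 1 ≤ q) (f g : MeasClass n) (N : ℕ) :
    unitBallTail q (f + g) N ≤ 2 ^ (q - 1) * (unitBallTail q f N + unitBallTail q g N) := by
  refine iSup_le fun x => ?_
  have hm : ∀ f : MeasClass n, AEMeasurable (((ball (0 : EuclideanSpace ℝ (Fin n)) N)ᶜ).indicator
      (fun y => ‖f y‖ₑ ^ q)) (volume.restrict (ball x 1)) := fun f =>
    (f.aestronglyMeasurable.enorm.pow_const q).restrict.indicator measurableSet_ball.compl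
  calc _ ≤ ∫⁻ y in ball x 1, 2 ^ (q - 1) *
        (((ball (0 : EuclideanSpace ℝ (Fin n)) N)ᶜ).indicator (fun y => ‖f y‖ₑ ^ q) y +
          ((ball (0 : EuclideanSpace ℝ (Fin n)) N)ᶜ).indicator (fun y => ‖g y‖ₑ ^ q) y) := by
        refine lintegral_mono_ae ?_
        filter_upwards [ae_restrict_of_ae (AEEqFun.coeFn_add f g)] with y hy
        by_cases h : y ∈ (ball (0 : EuclideanSpace ℝ (Fin n)) N)ᶜ
        · simp only [Set.indicator_of_mem h, hy, Pi.add_apply]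
          rw [mul_add]
          exact (ENNReal.rpow_le_rpow (enorm_add_le _ _) (by linarith)).trans
            (ENNReal.rpow_add_le_mul_rpow_add_rpow _ _ hq |>.trans_eq (mul_add _ _ _))
        · simp [Set.indicator_of_notMem h]
    _ = 2 ^ (q - 1) *
        ((∫⁻ y in ball x 1, ((ball (0 : EuclideanSpace ℝ (Fin n)) N)ᶜ).indicator
            (fun y => ‖f y‖ₑ ^ q) y) +
          ∫⁻ y in ball x 1, ((ball (0 : EuclideanSpace ℝ (Fin n)) N)ᶜ).indicator
            (fun y => ‖g y‖ₑ ^ q) y) := by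
        rw [lintegral_const_mul' _ _ (ENNReal.rpow_ne_top_of_nonneg (by linarith) (by simp)),
          lintegral_add_left' (hm f)]
    _ ≤ _ := by
        gcongr
        · exact le_iSup (fun x => ∫⁻ y in ball x 1,
            ((ball (0 : EuclideanSpace ℝ (Fin n)) N)ᶜ).indicator (fun y => ‖f y‖ₑ ^ q) y) x
        · exact le_iSup (fun x => ∫⁻ y in ball x 1,
            ((ball (0 : EuclideanSpace ℝ (Fin n)) N)ᶜ).indicator (fun y => ‖g y‖ₑ ^ q) y) x

lemma unitBallTail_smul {n : ℕ} {q : ℝ} (hq : 0 < q) (c : ℂ) (f : MeasClass n) (N : ℕ) :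
    unitBallTail q (c • f) N = ‖c‖ₑ ^ q * unitBallTail q f N := by
  unfold unitBallTail
  rw [ENNReal.mul_iSup]
  congr 1 with x
  rw [← lintegral_const_mul' _ _ (ENNReal.rpow_ne_top_of_nonneg hq.le enorm_ne_top)]
  refine lintegral_congr_ae ?_
  filter_upwards [ae_restrict_of_ae (AEEqFun.coeFn_smul c f)] with y hy
  by_cases h : y ∈ (ball (0 : EuclideanSpace ℝ (Fin n)) N)ᶜ
  · simp only [Set.indicator_of_mem h, hy, Pi.smul_apply, smul_eq_mul, enorm_mul,
      ENNReal.mul_rpow_of_nonneg _ _ hq.le]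
  · simp [Set.indicator_of_notMem h]

/-- The space `V^{(*)}𝓜^p_q`, with the Morrey norm. -/
def vanishingStar : Submodule ℂ (morreySpace n p q) where
  carrier := {f | Tendsto (fun N : ℕ => unitBallTail q f.1 N) atTop (𝓝 0)}
  zero_mem' := by
    simp [unitBallTail_zero (lt_of_lt_of_le one_pos hq.out)]
  add_mem' {f g} hf hg := by
    have h := ENNReal.Tendsto.const_mul (a := 2 ^ (q - 1)) (Tendsto.add hf hg)
      (Or.inr (ENNReal.rpow_ne_top_of_nonneg (by linarith [hq.out]) (by simp)))
    rw [add_zero, mul_zero] at h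
    exact tendsto_of_tendsto_of_tendsto_of_le_of_le tendsto_const_nhds h (fun _ => zero_le)
      (fun N => unitBallTail_add_le hq.out f.1 g.1 N)
  smul_mem' c f hf := by
    have hq0 : 0 < q := lt_of_lt_of_le one_pos hq.out
    have h := ENNReal.Tendsto.const_mul (a := ‖c‖ₑ ^ q) hf
      (Or.inr (ENNReal.rpow_ne_top_of_nonneg hq0.le enorm_ne_top))
    rw [mul_zero] at h
    simpa [unitBallTail_smul hq0] using h

variable {n p q}

/-- The inclusion of a subspace of a Morrey space in the space of all measurable functions. -/
def inclusionMeas (V : Submodule ℂ (morreySpace n p q)) : V →ₗ[ℂ] MeasClass n :=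
  (morreySpace n p q).subtype ∘ₗ V.subtype

/-- Any two subspaces of Morrey spaces form a compatible couple. -/
instance {p₀ q₀ p₁ q₁ : ℝ} [Fact (1 ≤ q₀)] [Fact (1 ≤ q₁)]
    (V₀ : Submodule ℂ (morreySpace n p₀ q₀)) (V₁ : Submodule ℂ (morreySpace n p₁ q₁)) :
    CompatibleCouple (inclusionMeas V₀) (inclusionMeas V₁) where
  injective₀ := fun a b h => Subtype.ext (Subtype.ext h)
  injective₁ := fun a b h => Subtype.ext (Subtype.ext h)
  isClosed_ker := by
    refine isClosed_of_closure_subset fun u hu => ?_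
    have key : ∀ v : WithLp 1 (V₀ × V₁), sumMap (inclusionMeas V₀) (inclusionMeas V₁) v =
        (v.fst.1.1 + v.snd.1.1 : MeasClass n) := fun v => rfl
    refine LinearMap.mem_ker.2 (eq_zero_of_lintegral_ball _ fun r hr => ?_)
    obtain ⟨C₀, hC₀, h₀⟩ := lintegral_ball_le_morreyENorm (n := n) (p := p₀)
      (Fact.out : 1 ≤ q₀) hr
    obtain ⟨C₁, hC₁, h₁⟩ := lintegral_ball_le_morreyENorm (n := n) (p := p₁)
      (Fact.out : 1 ≤ q₁) hr
    have e₀ : ∀ a : V₀, morreyENorm p₀ q₀ a.1.1 = ‖a‖ₑ := fun a => by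
      rw [← ofReal_norm, Submodule.coe_norm, norm_morreySpace_def, ENNReal.ofReal_toReal a.1.2.ne]
    have e₁ : ∀ a : V₁, morreyENorm p₁ q₁ a.1.1 = ‖a‖ₑ := fun a => by
      rw [← ofReal_norm, Submodule.coe_norm, norm_morreySpace_def, ENNReal.ofReal_toReal a.1.2.ne]
    obtain ⟨v, hv, hlim⟩ := mem_closure_iff_seq_limit.1 hu
    have hb : ∀ k, ∫⁻ y in ball (0 : EuclideanSpace ℝ (Fin n)) r,
        ‖(sumMap (inclusionMeas V₀) (inclusionMeas V₁) u) y‖ₑ ≤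
        C₀ * ‖(u - v k).fst‖ₑ + C₁ * ‖(u - v k).snd‖ₑ := by
      intro k
      have hk : sumMap (inclusionMeas V₀) (inclusionMeas V₁) u =
          ((u - v k).fst.1.1 + (u - v k).snd.1.1 : MeasClass n) := by
        rw [← key, map_sub, LinearMap.mem_ker.1 (hv k), sub_zero]
      rw [hk, ← e₀, ← e₁]
      refine le_trans ?_ (add_le_add (h₀ _) (h₁ _))
      rw [← lintegral_add_left' (AEEqFun.aestronglyMeasurable _).enorm.restrict]
      refine lintegral_mono_ae ?_
      filter_upwards [ae_restrict_of_ae (AEEqFun.coeFn_add (μ := volume)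
        ((u - v k).fst.1.1 : MeasClass n) ((u - v k).snd.1.1 : MeasClass n))] with y hy
      rw [hy]
      exact enorm_add_le _ _
    have hsub : Tendsto (fun k => u - v k) atTop (𝓝 0) := by
      simpa using (tendsto_const_nhds (x := u)).sub hlim
    have l₀ : Tendsto (fun k => ‖(u - v k).fst‖ₑ) atTop (𝓝 0) := by
      have := ((WithLp.prod_continuous_ofLp 1 V₀ V₁).fst.enorm.tendsto 0).comp hsub
      rw [show ‖(WithLp.ofLp (0 : WithLp 1 (V₀ × V₁))).fst‖ₑ = 0 from enorm_zero (E := V₀)] at this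
      exact this
    have l₁ : Tendsto (fun k => ‖(u - v k).snd‖ₑ) atTop (𝓝 0) := by
      have := ((WithLp.prod_continuous_ofLp 1 V₀ V₁).snd.enorm.tendsto 0).comp hsub
      rw [show ‖(WithLp.ofLp (0 : WithLp 1 (V₀ × V₁))).snd‖ₑ = 0 from enorm_zero (E := V₁)] at this
      exact this
    have l := (ENNReal.Tendsto.const_mul l₀ (Or.inr hC₀)).add
      (ENNReal.Tendsto.const_mul l₁ (Or.inr hC₁))
    simp only [mul_zero, add_zero] at l
    exact le_antisymm (ge_of_tendsto' l hb) zero_le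

/-! ## The function `f₂` -/

/-- The cube `c e₁ + [0,1]ⁿ`. -/
def shiftedCube (n : ℕ) [NeZero n] (c : ℝ) : Set (EuclideanSpace ℝ (Fin n)) :=
  {x | ∀ i, (x - EuclideanSpace.single 0 c : EuclideanSpace ℝ (Fin n)) i ∈ Set.Icc (0 : ℝ) 1}

/-- `f₂ = ∑_{j ≥ 1} χ_{j! e₁ + [0,1]ⁿ}`; at each point only finitely many terms are nonzero. -/
def fTwo (n : ℕ) [NeZero n] (x : EuclideanSpace ℝ (Fin n)) : ℂ :=
  ∑' j : ℕ, (shiftedCube n (Nat.factorial (j + 1) : ℝ)).indicator (fun _ => 1) x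

lemma measurable_fTwo (n : ℕ) [NeZero n] : Measurable (fTwo n) := by
  have hs : ∀ c, MeasurableSet (shiftedCube n c) := fun c => by
    have : shiftedCube n c = ⋂ i, (fun x : EuclideanSpace ℝ (Fin n) =>
        (x - EuclideanSpace.single 0 c : EuclideanSpace ℝ (Fin n)) i) ⁻¹' Set.Icc (0 : ℝ) 1 := by
      ext x; simp [shiftedCube]
    rw [this]
    exact MeasurableSet.iInter fun i => IsClosed.measurableSet
      (isClosed_Icc.preimage (by fun_prop))
  have hfin : ∀ x : EuclideanSpace ℝ (Fin n), HasSum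
      (fun j : ℕ => (shiftedCube n (Nat.factorial (j + 1) : ℝ)).indicator (fun _ => (1 : ℂ)) x) (fTwo n x) := by
    intro x
    refine Summable.hasSum (summable_of_hasFiniteSupport ?_)
    obtain ⟨N, hN⟩ := exists_nat_gt (x 0)
    refine (Set.finite_lt_nat N).subset fun j hj => ?_
    by_contra hlt
    have hmem : x ∈ shiftedCube n (Nat.factorial (j + 1) : ℝ) := by
      by_contra h
      exact hj (Set.indicator_of_notMem h _)
    have h0 := (hmem 0).1
    simp only [PiLp.sub_apply, PiLp.single_apply, if_true] at h0
    have h1 : (N : ℝ) ≤ (Nat.factorial (j + 1) : ℝ) := by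
      have h2 : N ≤ j := not_lt.1 hlt
      exact_mod_cast (h2.trans (Nat.le_succ j)).trans (Nat.self_le_factorial (j + 1))
    linarith
  exact measurable_of_tendsto_metrizable
    (f := fun (N : ℕ) (x : EuclideanSpace ℝ (Fin n)) => ∑ j ∈ Finset.range N,
      (shiftedCube n (Nat.factorial (j + 1) : ℝ)).indicator (fun _ => (1 : ℂ)) x)
    (fun N => Finset.measurable_fun_sum _ fun j _ => measurable_const.indicator (hs _))
    (tendsto_pi_nhds.2 fun x => (hfin x).tendsto_sum_nat)

/-- The almost-everywhere class of `f₂`. -/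
def fTwoClass (n : ℕ) [NeZero n] : MeasClass n :=
  AEEqFun.mk (fTwo n) (measurable_fTwo n).aestronglyMeasurable

end

/-!
The complex interpolation space `[X₀, X₁]_θ` lies between the intersection `X₀ ∩ X₁` (constant
functions are Calderón functions) and the sum `X₀ + X₁`, and both assertions about `fTwo` already
hold for these two extreme spaces.

* `fTwo` lies in the intersection of the spaces `V_∞𝓜^p_q` for all `1 ≤ q < p`. Factorials are so
  sparse that a ball of large radius `r` meets only `O(log r)` cubes
  (`two_pow_card_le_of_factorial_mem_Icc`, `exists_finset_cubes`). Hence `m(fTwo, p, q; r)` is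
  bounded by a power of `log r` times `r ^ (n (1/p - 1/q))` (`morreyM_fTwoClass_le`), which tends
  to `0` because `q < p`. For bounded radii `m` is bounded since `fTwo` is bounded.
* `fTwo` is not a sum `a + b` with `a`, `b` in spaces `V^{(*)}𝓜^p_q` (`add_ne_fTwoClass`). Each
  cube contains a ball of radius `1/2`, on which `|a + b| ≥ 1` and hence `|a| ≥ 1/2` or
  `|b| ≥ 1/2`. Integrating over such balls going to infinity bounds their common volume by the tails
  of `a` and `b` (`volume_ball_le_unitBallTail`), which tend to `0`.
-/

/-! ### Factorials in an interval -/

lemma two_pow_le_factorial_succ (m : ℕ) : 2 ^ m ≤ (m + 1).factorial := by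
  induction m with
  | zero => simp
  | succ k ih =>
    rw [pow_succ, Nat.factorial_succ (k + 1), mul_comm]
    exact Nat.mul_le_mul (by omega) ih

/-- An interval of length `L` contains at most `log₂ (4 (L + 1))` factorials: the largest of them,
`(m + 1)!`, is at distance at least `m * m!` from all the others. -/
lemma two_pow_card_le_of_factorial_mem_Icc {J : Finset ℕ} {a L : ℝ} (hL : 0 ≤ L)
    (h : ∀ j ∈ J, ((j + 1).factorial : ℝ) ∈ Set.Icc a (a + L)) :
    (2 : ℝ) ^ J.card ≤ 4 * (L + 1) := by
  rcases Nat.lt_or_ge 1 J.card with hJ | hJ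
  · have hne : J.Nonempty := Finset.card_pos.1 (by omega)
    set m := J.max' hne
    obtain ⟨k, hk, hkm⟩ := Finset.exists_mem_ne hJ m
    have hlt : k + 1 ≤ m := lt_of_le_of_ne (J.le_max' k hk) hkm
    have hcard : J.card ≤ m + 1 := by
      simpa using Finset.card_le_card (t := Finset.range (m + 1))
        fun j hj => Finset.mem_range.2 (Nat.lt_succ_of_le (J.le_max' j hj))
    have hgap : ((m + 1).factorial : ℝ) - (m.factorial : ℝ) ≤ L := by
      have h1 := (h m (J.max'_mem hne)).2
      have h2 := (h k hk).1
      have h3 : ((k + 1).factorial : ℝ) ≤ (m.factorial : ℝ) := by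
        exact_mod_cast Nat.factorial_le hlt
      linarith
    have hm : (1 : ℝ) ≤ m := by exact_mod_cast (by omega : 1 ≤ m)
    have hfac : ((m + 1).factorial : ℝ) = (m + 1) * (m.factorial : ℝ) := by
      rw [Nat.factorial_succ]; push_cast; ring
    have hpow : (2 : ℝ) ^ m ≤ ((m + 1).factorial : ℝ) := by
      exact_mod_cast two_pow_le_factorial_succ m
    have hpos : (0 : ℝ) ≤ (m.factorial : ℝ) := Nat.cast_nonneg _
    calc (2 : ℝ) ^ J.card ≤ 2 ^ (m + 1) := pow_le_pow_right₀ one_le_two hcard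
      _ = 2 * 2 ^ m := by ring
      _ ≤ 4 * (L + 1) := by nlinarith
  · calc (2 : ℝ) ^ J.card ≤ 2 ^ 1 := pow_le_pow_right₀ one_le_two hJ
      _ ≤ 4 * (L + 1) := by linarith

/-! ### The cubes meeting a ball -/

section Cubes

variable {n : ℕ} [NeZero n]

lemma mem_shiftedCube_iff {c : ℝ} {x : EuclideanSpace ℝ (Fin n)} :
    x ∈ shiftedCube n c ↔
      ∀ i, x i - (if i = 0 then c else 0) ∈ Set.Icc (0 : ℝ) 1 := by
  simp [shiftedCube, PiLp.single_apply]

lemma volume_shiftedCube (c : ℝ) : volume (shiftedCube n c) = 1 := by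
  have h : shiftedCube n c = WithLp.ofLp ⁻¹'
      Set.Icc (fun i : Fin n => if i = 0 then c else 0) (fun i => (if i = 0 then c else 0) + 1) := by
    ext x
    simp only [mem_shiftedCube_iff, Set.mem_preimage, Set.mem_Icc, Pi.le_def, ← forall_and]
    refine forall_congr' fun i => ?_
    constructor <;> rintro ⟨h1, h2⟩ <;> constructor <;> linarith
  rw [h, (PiLp.volume_preserving_ofLp (Fin n)).measure_preimage
    measurableSet_Icc.nullMeasurableSet, Real.volume_Icc_pi]
  simp

/-- A bound, valid for `r ≥ 9`, for the number of cubes of `fTwo` that meet a ball of radius `r`: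
it is `log₂ (r ^ 2)`. -/
noncomputable def cubeBound (r : ℝ) : ℝ := 2 / Real.log 2 * Real.log r

lemma one_le_cubeBound {r : ℝ} (hr : 9 ≤ r) : 1 ≤ cubeBound r := by
  have h2 : 0 < Real.log 2 := Real.log_pos one_lt_two
  have h : Real.log 2 ≤ Real.log r := Real.log_le_log two_pos (by linarith)
  rw [cubeBound, div_mul_eq_mul_div, le_div_iff₀ h2]
  linarith

lemma exists_finset_cubes (x : EuclideanSpace ℝ (Fin n)) {r : ℝ} (hr : 9 ≤ r) :
    ∃ J : Finset ℕ, (J.card : ℝ) ≤ cubeBound r ∧ ∀ y ∈ ball x r, ∀ j : ℕ,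
      y ∈ shiftedCube n (Nat.factorial (j + 1) : ℝ) → j ∈ J := by
  obtain ⟨N, hN⟩ := exists_nat_gt (x 0 + r)
  classical
  set J := (Finset.range N).filter fun j : ℕ => ((j + 1).factorial : ℝ) ∈
    Set.Icc (x 0 - r - 1) (x 0 - r - 1 + (2 * r + 1))
  refine ⟨J, ?_, fun y hy j hj => ?_⟩
  · have h := two_pow_card_le_of_factorial_mem_Icc (J := J) (by linarith : 0 ≤ 2 * r + 1)
      fun j hj => (Finset.mem_filter.1 hj).2
    -- `4 * (2 * r + 1 + 1) ≤ r ^ 2` holds for `r ≥ 9`.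
    have h' := Real.log_le_log (by positivity) (h.trans (by nlinarith : _ ≤ r ^ 2))
    rw [Real.log_pow, Real.log_pow] at h'
    rw [cubeBound, div_mul_eq_mul_div, le_div_iff₀ (Real.log_pos one_lt_two)]
    exact_mod_cast h'
  · have h1 := (PiLp.norm_apply_le (y - x) 0).trans_lt (mem_ball_iff_norm.1 hy)
    rw [PiLp.sub_apply, Real.norm_eq_abs, abs_lt] at h1
    have h2 := mem_shiftedCube_iff.1 hj 0
    rw [if_pos rfl, Set.mem_Icc] at h2
    refine Finset.mem_filter.2 ⟨Finset.mem_range.2 ?_, by linarith, by linarith⟩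
    have h3 : ((j + 1 : ℕ) : ℝ) ≤ ((j + 1).factorial : ℝ) := by
      exact_mod_cast Nat.self_le_factorial _
    have h4 : (j : ℝ) < N := by push_cast at h3; linarith
    exact_mod_cast h4

lemma fTwo_eq_sum {J : Finset ℕ} {y : EuclideanSpace ℝ (Fin n)}
    (hJ : ∀ j : ℕ, y ∈ shiftedCube n (Nat.factorial (j + 1) : ℝ) → j ∈ J) :
    fTwo n y = ∑ j ∈ J,
      (shiftedCube n (Nat.factorial (j + 1) : ℝ)).indicator (fun _ => (1 : ℂ)) y :=
  tsum_eq_sum fun j hj => Set.indicator_of_notMem (fun h => hj (hJ j h)) _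

lemma enorm_fTwo_le (x : EuclideanSpace ℝ (Fin n)) {r : ℝ} (hr : 9 ≤ r) {y : EuclideanSpace ℝ (Fin n)}
    (hy : y ∈ ball x r) : ‖fTwo n y‖ₑ ≤ ENNReal.ofReal (cubeBound r) := by
  obtain ⟨J, hJ, h⟩ := exists_finset_cubes x hr
  rw [← ofReal_norm, fTwo_eq_sum (h y hy)]
  refine ENNReal.ofReal_le_ofReal ((norm_sum_le _ _).trans (le_trans ?_ hJ))
  rw [← nsmul_one]
  refine Finset.sum_le_card_nsmul _ _ _ fun j _ => ?_
  exact (norm_indicator_le_norm_self _ _).trans (by simp)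

lemma lintegral_fTwo_le {q : ℝ} (hq : 0 < q) (x : EuclideanSpace ℝ (Fin n)) {r : ℝ} (hr : 9 ≤ r) :
    ∫⁻ y in ball x r, ‖fTwo n y‖ₑ ^ q ≤ ENNReal.ofReal (cubeBound r ^ (q + 1)) := by
  have hκ := one_le_cubeBound hr
  obtain ⟨J, hJ, h⟩ := exists_finset_cubes x hr
  set U := ⋃ j ∈ J, shiftedCube n (Nat.factorial (j + 1) : ℝ)
  have hU : volume U ≤ ENNReal.ofReal (cubeBound r) := by
    refine (measure_biUnion_finset_le _ _).trans ?_
    simp only [volume_shiftedCube, Finset.sum_const, nsmul_eq_mul, mul_one]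
    rw [← ENNReal.ofReal_natCast]
    exact ENNReal.ofReal_le_ofReal hJ
  calc ∫⁻ y in ball x r, ‖fTwo n y‖ₑ ^ q
      ≤ ∫⁻ y in ball x r, U.indicator (fun _ => ENNReal.ofReal (cubeBound r) ^ q) y := by
        refine setLIntegral_mono' measurableSet_ball fun y hy => ?_
        by_cases hyU : y ∈ U
        · rw [Set.indicator_of_mem hyU]
          exact ENNReal.rpow_le_rpow (enorm_fTwo_le x hr hy) hq.le
        · have h0 : fTwo n y = 0 := by
            rw [fTwo_eq_sum (h y hy)]
            refine Finset.sum_eq_zero fun j hj => Set.indicator_of_notMem (fun hyj => hyU ?_) _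
            exact Set.mem_biUnion (Finset.mem_coe.2 hj) hyj
          simp [h0, hq]
    _ ≤ ENNReal.ofReal (cubeBound r) ^ q * volume U :=
        (setLIntegral_le_lintegral _ _).trans (lintegral_indicator_const_le _ _)
    _ ≤ ENNReal.ofReal (cubeBound r) ^ q * ENNReal.ofReal (cubeBound r) := by gcongr
    _ = ENNReal.ofReal (cubeBound r ^ (q + 1)) := by
        rw [ENNReal.ofReal_rpow_of_nonneg (by linarith) hq.le,
          ← ENNReal.ofReal_mul (Real.rpow_nonneg (by linarith) _),
          Real.rpow_add_one (by linarith)]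

/-! ### Membership of `fTwo` in the vanishing Morrey space at infinity -/

lemma morreyLocal_fTwoClass (p q : ℝ) (x : EuclideanSpace ℝ (Fin n)) (r : ℝ) :
    morreyLocal p q (fTwoClass n) x r =
      volume (ball x r) ^ (1 / p) * (⨍⁻ y in ball x r, ‖fTwo n y‖ₑ ^ q ∂volume) ^ (1 / q) := by
  rw [morreyLocal, laverage_congr]
  refine ae_restrict_of_ae ?_
  filter_upwards [AEEqFun.coeFn_mk (fTwo n) (measurable_fTwo n).aestronglyMeasurable] with y hy
  rw [fTwoClass, hy]

/-- The volume of the unit ball of `ℝⁿ`. -/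
noncomputable def unitBallVolume (n : ℕ) : ℝ := (volume (ball (0 : EuclideanSpace ℝ (Fin n)) 1)).toReal

omit [NeZero n] in
lemma unitBallVolume_pos : 0 < unitBallVolume n :=
  ENNReal.toReal_pos (measure_ball_pos volume _ one_pos).ne' measure_ball_lt_top.ne

lemma volume_ball_eq (x : EuclideanSpace ℝ (Fin n)) {r : ℝ} (hr : 0 ≤ r) :
    volume (ball x r) = ENNReal.ofReal (unitBallVolume n * r ^ n) := by
  rw [Measure.addHaar_ball volume x hr, finrank_euclideanSpace_fin, mul_comm,
    ENNReal.ofReal_mul unitBallVolume_pos.le, unitBallVolume,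
    ENNReal.ofReal_toReal measure_ball_lt_top.ne]

lemma morreyM_fTwoClass_le {p q : ℝ} (hq : 1 ≤ q) {r : ℝ} (hr : 9 ≤ r) :
    morreyM p q (fTwoClass n) r ≤ ENNReal.ofReal
      ((unitBallVolume n * r ^ n) ^ (1 / p - 1 / q) * cubeBound r ^ ((q + 1) * (1 / q))) := by
  have hκ := one_le_cubeBound hr
  have hV : 0 < unitBallVolume n * r ^ n := mul_pos unitBallVolume_pos (by positivity)
  have hq0 : 0 < q := by linarith
  refine iSup_le fun x => ?_
  rw [morreyLocal_fTwoClass, setLAverage_eq, volume_ball_eq x (by linarith)]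
  calc _ ≤ ENNReal.ofReal (unitBallVolume n * r ^ n) ^ (1 / p) *
        (ENNReal.ofReal (cubeBound r ^ (q + 1)) / ENNReal.ofReal (unitBallVolume n * r ^ n))
          ^ (1 / q) := by
        gcongr
        exact lintegral_fTwo_le hq0 x hr
    _ = _ := by
        rw [← ENNReal.ofReal_div_of_pos hV, ENNReal.ofReal_rpow_of_pos hV,
          ENNReal.ofReal_rpow_of_nonneg (by positivity) (by positivity),
          ← ENNReal.ofReal_mul (by positivity), Real.div_rpow (by positivity) hV.le,
          Real.rpow_sub hV, Real.rpow_mul (by linarith)]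
        congr 1
        ring

lemma tendsto_morreyM_fTwoClass {p q : ℝ} (hq : 1 ≤ q) (hqp : q < p) :
    Tendsto (fun r : ℝ => morreyM p q (fTwoClass n) r) atTop (𝓝 0) := by
  set s := (q + 1) * (1 / q)
  have hδ : 0 < 1 / q - 1 / p := sub_pos.2 (one_div_lt_one_div_of_lt (by linarith) hqp)
  have hn : (0 : ℝ) < n := by exact_mod_cast Nat.pos_of_ne_zero (NeZero.ne n)
  have hlog := (isLittleO_log_rpow_rpow_atTop s (mul_pos hn hδ)).tendsto_div_nhds_zero
  have hlim := ENNReal.tendsto_ofReal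
    (hlog.const_mul (unitBallVolume n ^ (1 / p - 1 / q) * (2 / Real.log 2) ^ s))
  rw [mul_zero, ENNReal.ofReal_zero] at hlim
  refine tendsto_of_tendsto_of_tendsto_of_le_of_le' tendsto_const_nhds hlim
    (Eventually.of_forall fun _ => zero_le) ?_
  filter_upwards [eventually_ge_atTop 9] with r hr
  refine (morreyM_fTwoClass_le hq hr).trans_eq ?_
  have h2 : 0 < Real.log 2 := Real.log_pos one_lt_two
  have hr0 : 0 < r := by linarith
  have hpow : (r ^ n) ^ (1 / p - 1 / q) = (r ^ (n * (1 / q - 1 / p)))⁻¹ := by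
    rw [← Real.rpow_natCast, ← Real.rpow_mul hr0.le, ← Real.rpow_neg hr0.le]
    congr 1
    ring
  rw [cubeBound, Real.mul_rpow unitBallVolume_pos.le (by positivity), hpow,
    Real.mul_rpow (by positivity) (Real.log_nonneg (by linarith))]
  congr 1
  ring

/-- The Morrey norm of `fTwo` is finite: large radii are controlled by the limit at infinity, small
ones by the boundedness of `fTwo`. -/
lemma morreyENorm_fTwoClass_lt_top {p q : ℝ} (hq : 1 ≤ q) (hqp : q < p) :
    morreyENorm p q (fTwoClass n) < ∞ := by
  have hq0 : 0 < q := by linarith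
  have hp0 : 0 < p := by linarith
  obtain ⟨R₀, hR₀⟩ := eventually_atTop.1
    ((tendsto_morreyM_fTwoClass (n := n) hq hqp).eventually (ge_mem_nhds one_pos))
  set R := max R₀ 9
  have hR : 9 ≤ R := le_max_right _ _
  set B := ENNReal.ofReal (unitBallVolume n * R ^ n) ^ (1 / p) * ENNReal.ofReal (cubeBound R)
  have hB : B < ∞ := ENNReal.mul_lt_top
    (ENNReal.rpow_lt_top_of_nonneg (by positivity) ENNReal.ofReal_ne_top) ENNReal.ofReal_lt_top
  refine lt_of_le_of_lt (iSup₂_le fun r hr => ?_) (max_lt ENNReal.one_lt_top hB)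
  rcases le_total R r with h | h
  · exact (hR₀ r ((le_max_left _ _).trans h)).trans (le_max_left _ _)
  · refine (iSup_le fun x => ?_).trans (le_max_right _ _)
    have hsub : ball x r ⊆ ball x R := ball_subset_ball h
    have hav : ⨍⁻ y in ball x r, ‖fTwo n y‖ₑ ^ q ∂volume ≤ ENNReal.ofReal (cubeBound R) ^ q := by
      rw [setLAverage_eq]
      refine ENNReal.div_le_of_le_mul ?_
      rw [← setLIntegral_const]
      exact setLIntegral_mono' measurableSet_ball fun y hy =>
        ENNReal.rpow_le_rpow (enorm_fTwo_le x hR (hsub hy)) hq0.le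
    rw [morreyLocal_fTwoClass]
    refine mul_le_mul' (ENNReal.rpow_le_rpow ?_ (by positivity)) ?_
    · rw [← volume_ball_eq x (by linarith)]
      exact measure_mono hsub
    · refine (ENNReal.rpow_le_rpow hav (by positivity)).trans_eq ?_
      rw [← ENNReal.rpow_mul, mul_one_div_cancel hq0.ne', ENNReal.rpow_one]

/-- The function `fTwo` as an element of the vanishing Morrey space at infinity. -/
noncomputable def fTwoVanishing (n : ℕ) [NeZero n] {p q : ℝ} [hq : Fact (1 ≤ q)] (hqp : q < p) :
    vanishingAtInfinity n p q :=
  ⟨⟨fTwoClass n, morreyENorm_fTwoClass_lt_top hq.out hqp⟩, tendsto_morreyM_fTwoClass hq.out hqp⟩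

/-! ### Interpolation spaces between the intersection and the sum -/

section Interpolation

variable {X₀ X₁ Z : Type*} [NormedAddCommGroup X₀] [NormedSpace ℂ X₀]
  [NormedAddCommGroup X₁] [NormedSpace ℂ X₁] [AddCommGroup Z] [Module ℂ Z]

/-- The intersection `X₀ ∩ X₁` is contained in `[X₀, X₁]_θ`: constant functions are Calderón
functions. -/
lemma mem_firstInterpolation_of_mem_inter (i₀ : X₀ →ₗ[ℂ] Z) (i₁ : X₁ →ₗ[ℂ] Z)
    [CompatibleCouple i₀ i₁] (θ : ℝ) {a : X₀} {b : X₁} (hab : i₀ a = i₁ b) :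
    i₀ a ∈ firstInterpolation i₀ i₁ θ := by
  have hinr : SumSpace.inl i₀ i₁ a = SumSpace.inr i₀ i₁ b := by
    refine (Submodule.Quotient.eq _).2 ?_
    simp [sumMap, hab]
  refine ⟨fun _ => SumSpace.inl i₀ i₁ a, ⟨continuousOn_const, ⟨_, fun _ _ => le_rfl⟩,
    differentiableOn_const _, ⟨BoundedContinuousFunction.const ℝ a, fun _ => rfl⟩,
    ⟨BoundedContinuousFunction.const ℝ b, fun _ => hinr⟩⟩, ?_⟩
  change i₀ a + i₁ 0 = i₀ a
  rw [map_zero, add_zero]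

/-- `[X₀, X₁]_θ` is contained in the sum `X₀ + X₁`. -/
lemma exists_add_eq_of_mem_firstInterpolation {i₀ : X₀ →ₗ[ℂ] Z} {i₁ : X₁ →ₗ[ℂ] Z}
    [CompatibleCouple i₀ i₁] {θ : ℝ} {f : Z} (hf : f ∈ firstInterpolation i₀ i₁ θ) :
    ∃ (a : X₀) (b : X₁), i₀ a + i₁ b = f := by
  obtain ⟨F, -, hF⟩ := hf
  obtain ⟨u, hu⟩ := Submodule.Quotient.mk_surjective _ (F θ)
  refine ⟨u.fst, u.snd, ?_⟩
  rw [← hF, ← hu]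
  rfl

end Interpolation

omit [NeZero n] in
lemma inclusionMeas_apply {p q : ℝ} [Fact (1 ≤ q)] (V : Submodule ℂ (morreySpace n p q)) (f : V) :
    inclusionMeas V f = f.1.1 :=
  rfl

/-! ### `fTwo` is not a sum of functions from the spaces `V^{(*)}` -/

/-- The centre of the cube `c e₁ + [0,1]ⁿ`. -/
noncomputable def cubeCentre (n : ℕ) [NeZero n] (c : ℝ) : EuclideanSpace ℝ (Fin n) :=
  EuclideanSpace.single 0 c + WithLp.toLp 2 fun _ => 1 / 2

lemma ball_cubeCentre_subset (c : ℝ) : ball (cubeCentre n c) (1 / 2) ⊆ shiftedCube n c := by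
  intro y hy
  rw [mem_shiftedCube_iff]
  intro i
  have h := (PiLp.norm_apply_le (y - cubeCentre n c) i).trans_lt (mem_ball_iff_norm.1 hy)
  simp only [cubeCentre, PiLp.sub_apply, PiLp.add_apply, PiLp.single_apply, Real.norm_eq_abs,
    abs_lt] at h
  constructor <;> linarith

lemma one_le_enorm_fTwo {j : ℕ} {y : EuclideanSpace ℝ (Fin n)}
    (hy : y ∈ shiftedCube n (Nat.factorial (j + 1) : ℝ)) : 1 ≤ ‖fTwo n y‖ₑ := by
  obtain ⟨J, -, hJ⟩ := exists_finset_cubes y le_rfl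
  have hJy := hJ y (mem_ball_self (by norm_num))
  classical
  have h : fTwo n y = ((∑ i ∈ J, if y ∈ shiftedCube n (Nat.factorial (i + 1) : ℝ) then 1 else 0 :
      ℕ) : ℂ) := by
    rw [fTwo_eq_sum hJy]
    push_cast
    exact Finset.sum_congr rfl fun i _ => by simp [Set.indicator_apply]
  have h1 : 1 ≤ ∑ i ∈ J, if y ∈ shiftedCube n (Nat.factorial (i + 1) : ℝ) then 1 else 0 := by
    refine le_trans ?_ (Finset.single_le_sum (fun _ _ => Nat.zero_le _) (hJy j hy))
    rw [if_pos hy]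
  rw [h, ← ofReal_norm, Complex.norm_natCast, ENNReal.ofReal_natCast]
  exact_mod_cast h1

/-- If `|u + v| ≥ 1` then `|u| ≥ 1/2` or `|v| ≥ 1/2`. -/
lemma one_le_two_mul_rpow_add {q₀ q₁ : ℝ} (h₀ : 0 < q₀) (h₁ : 0 < q₁) {u v : ℂ}
    (h : 1 ≤ ‖u + v‖ₑ) :
    1 ≤ 2 ^ q₀ * ‖u‖ₑ ^ q₀ + 2 ^ q₁ * ‖v‖ₑ ^ q₁ := by
  have h' : 1 ≤ ‖u‖ₑ + ‖v‖ₑ := h.trans (enorm_add_le u v)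
  rw [← ENNReal.mul_rpow_of_nonneg _ _ h₀.le, ← ENNReal.mul_rpow_of_nonneg _ _ h₁.le]
  rcases le_total ‖u‖ₑ ‖v‖ₑ with huv | huv
  · have hv : 1 ≤ 2 * ‖v‖ₑ := by rw [two_mul]; exact h'.trans (by gcongr)
    exact (ENNReal.one_le_rpow hv h₁).trans le_add_self
  · have hu : 1 ≤ 2 * ‖u‖ₑ := by rw [two_mul]; exact h'.trans (by gcongr)
    exact (ENNReal.one_le_rpow hu h₀).trans le_self_add

omit [NeZero n] in
lemma lintegral_ball_le_unitBallTail {q : ℝ} (f : MeasClass n) {N : ℕ}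
    {x : EuclideanSpace ℝ (Fin n)} (hx : ball x (1 / 2) ⊆ (ball 0 N)ᶜ) :
    ∫⁻ y in ball x (1 / 2), ‖f y‖ₑ ^ q ≤ unitBallTail q f N := by
  calc ∫⁻ y in ball x (1 / 2), ‖f y‖ₑ ^ q
      = ∫⁻ y in ball x (1 / 2), ((ball 0 N)ᶜ).indicator (fun y => ‖f y‖ₑ ^ q) y :=
        setLIntegral_congr_fun measurableSet_ball fun y hy =>
          (Set.indicator_of_mem (hx hy) (fun y => ‖f y‖ₑ ^ q)).symm
    _ ≤ ∫⁻ y in ball x 1, ((ball 0 N)ᶜ).indicator (fun y => ‖f y‖ₑ ^ q) y :=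
        lintegral_mono_set (ball_subset_ball (by norm_num))
    _ ≤ _ := le_iSup (fun x => ∫⁻ y in ball x 1,
        ((ball (0 : EuclideanSpace ℝ (Fin n)) N)ᶜ).indicator (fun y => ‖f y‖ₑ ^ q) y) x

lemma volume_ball_le_unitBallTail {q₀ q₁ : ℝ} (h₀ : 0 < q₀) (h₁ : 0 < q₁) {f g : MeasClass n}
    (hfg : f + g = fTwoClass n) (N : ℕ) :
    volume (ball (0 : EuclideanSpace ℝ (Fin n)) (1 / 2)) ≤
      2 ^ q₀ * unitBallTail q₀ f N + 2 ^ q₁ * unitBallTail q₁ g N := by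
  set c : ℝ := (Nat.factorial (N + 1) : ℝ)
  set x := cubeCentre n c
  have hsub := ball_cubeCentre_subset (n := n) c
  -- Points of the cube have first coordinate at least `(N + 1)! ≥ N`.
  have hout : ball x (1 / 2) ⊆ (ball 0 (N : ℝ))ᶜ := by
    intro y hy hyN
    have h1 := (PiLp.norm_apply_le y 0).trans_lt (mem_ball_zero_iff.1 hyN)
    have h2 := (mem_shiftedCube_iff.1 (hsub hy) 0).1
    rw [if_pos rfl] at h2
    have h3 : (N : ℝ) ≤ c :=
      Nat.cast_le.2 <| (Nat.le_succ N).trans (Nat.self_le_factorial (N + 1))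
    linarith [le_abs_self (y 0), Real.norm_eq_abs (y 0)]
  have hone : ∀ᵐ y ∂volume.restrict (ball x (1 / 2)),
      1 ≤ 2 ^ q₀ * ‖f y‖ₑ ^ q₀ + 2 ^ q₁ * ‖g y‖ₑ ^ q₁ := by
    filter_upwards [ae_restrict_mem measurableSet_ball, ae_restrict_of_ae (AEEqFun.coeFn_add f g),
      ae_restrict_of_ae (AEEqFun.coeFn_mk (fTwo n) (measurable_fTwo n).aestronglyMeasurable)]
      with y hy hadd hmk
    refine one_le_two_mul_rpow_add h₀ h₁ ?_
    rw [← Pi.add_apply, ← hadd, hfg, fTwoClass, hmk]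
    exact one_le_enorm_fTwo (hsub hy)
  have hm : ∀ {q : ℝ} (f : MeasClass n),
      AEMeasurable (fun y => ‖f y‖ₑ ^ q) (volume.restrict (ball x (1 / 2))) := fun f =>
    (f.aestronglyMeasurable.enorm.pow_const _).restrict
  calc volume (ball (0 : EuclideanSpace ℝ (Fin n)) (1 / 2)) = volume (ball x (1 / 2)) := by
        rw [Measure.addHaar_ball_center volume x]
    _ = ∫⁻ _ in ball x (1 / 2), 1 := by rw [setLIntegral_one]
    _ ≤ ∫⁻ y in ball x (1 / 2), (2 ^ q₀ * ‖f y‖ₑ ^ q₀ + 2 ^ q₁ * ‖g y‖ₑ ^ q₁) :=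
        lintegral_mono_ae hone
    _ = 2 ^ q₀ * (∫⁻ y in ball x (1 / 2), ‖f y‖ₑ ^ q₀) +
          2 ^ q₁ * ∫⁻ y in ball x (1 / 2), ‖g y‖ₑ ^ q₁ := by
        rw [lintegral_add_left' ((hm f).const_mul _), lintegral_const_mul'' _ (hm f),
          lintegral_const_mul'' _ (hm g)]
    _ ≤ _ := by
        gcongr
        · exact lintegral_ball_le_unitBallTail f hout
        · exact lintegral_ball_le_unitBallTail g hout

lemma add_ne_fTwoClass {p₀ q₀ p₁ q₁ : ℝ} [hq₀ : Fact (1 ≤ q₀)] [hq₁ : Fact (1 ≤ q₁)]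
    (a : vanishingStar n p₀ q₀) (b : vanishingStar n p₁ q₁) :
    (a.1.1 + b.1.1 : MeasClass n) ≠ fTwoClass n := by
  intro hab
  have h₀ : 0 < q₀ := one_pos.trans_le hq₀.out
  have h₁ : 0 < q₁ := one_pos.trans_le hq₁.out
  have ha : Tendsto (fun N : ℕ => unitBallTail q₀ a.1.1 N) atTop (𝓝 0) := a.2
  have hb : Tendsto (fun N : ℕ => unitBallTail q₁ b.1.1 N) atTop (𝓝 0) := b.2
  have hlim := (ENNReal.Tendsto.const_mul (a := 2 ^ q₀) ha
      (Or.inr (ENNReal.rpow_ne_top_of_nonneg h₀.le (by simp)))).add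
    (ENNReal.Tendsto.const_mul (a := 2 ^ q₁) hb
      (Or.inr (ENNReal.rpow_ne_top_of_nonneg h₁.le (by simp))))
  rw [mul_zero, mul_zero, add_zero] at hlim
  have hle := ge_of_tendsto' hlim fun N => volume_ball_le_unitBallTail h₀ h₁ hab N
  exact (measure_ball_pos volume _ (by norm_num)).ne' (le_antisymm hle zero_le)

end Cubes

theorem corollary6p3 (n : ℕ) [NeZero n] (θ : ℝ) (hθ₀ : 0 < θ) (hθ₁ : θ < 1)
    (p₀ q₀ p₁ q₁ : ℝ) [Fact (1 ≤ q₀)] [Fact (1 ≤ q₁)] (h₀ : q₀ < p₀) (h₁ : q₁ < p₁)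
    (hpq : p₀ / q₀ = p₁ / q₁) :
    fTwoClass n ∈ firstInterpolation (inclusionMeas (vanishingAtInfinity n p₀ q₀))
        (inclusionMeas (vanishingAtInfinity n p₁ q₁)) θ ∧
      fTwoClass n ∉ firstInterpolation (inclusionMeas (vanishingStar n p₀ q₀))
        (inclusionMeas (vanishingStar n p₁ q₁)) θ := by
  refine ⟨?_, fun h => ?_⟩
  · have hmem := mem_firstInterpolation_of_mem_inter (inclusionMeas (vanishingAtInfinity n p₀ q₀))
      (inclusionMeas (vanishingAtInfinity n p₁ q₁)) θ (a := fTwoVanishing n h₀)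
      (b := fTwoVanishing n h₁)
    simp only [inclusionMeas_apply, fTwoVanishing, forall_const] at hmem
    exact hmem
  · obtain ⟨a, b, hab⟩ := exists_add_eq_of_mem_firstInterpolation h
    rw [inclusionMeas_apply, inclusionMeas_apply] at hab
    exact add_ne_fTwoClass a b hab
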